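/- **LCB sub-optimality for contextual bandits.** Let $\mathcal S$ and $\mathcal A$ be finite sets of states and actions, with $S=|\mathcal S|\ge 2$. A contextual bandit consists of a state distribution $\rho$ on $\mathcal S$ and, for every $(s,a)$, a reward distribution $R(\cdot\mid s,a)$ on $[0,1]$ with mean $r(s,a)$. A deterministic policy $\pi:\mathcal S\to\mathcal A$ has value $V^\pi(s)=r(s,\pi(s))$ and expected value $J(\pi)=\sum_s\rho(s)V^\pi(s)$. Let $\pi^\star$ be an optimal policy, i.e. one that maximizes $V^\pi(s)$ in every state $s$ simultaneously. Let $\mu$ be a probability distribution on $\mathcal S\times\mathcal A$, and let $\mathcal D=\{(s_i,a_i,r_i)\}_{i=1}^N$, $N\ge 1$, be i.i.d. with $(s_i,a_i)\sim\mu$ and $r_i\sim R(\cdot\mid s_i,a_i)$. Assume that $$\max_{s}\frac{\rho(s)}{\mu(s,\pi^\star(s))}\le C^\star$$ for some real $C^\star\ge 1$ (with $0/0=0$ and $x/0=\infty$ for $x>0$). The algorithm CB-LCB with confidence level $\delta$ works as follows. Let $N(s,a)=\#\{i:(s_i,a_i)=(s,a)\}$. If $N(s,a)=0$, set $\hat r(s,a)=0$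 and $b(s,a)=1$; otherwise set $$\hat r(s,a)=\frac1{N(s,a)}\sum_{i:(s_i,a_i)=(s,a)}r_i,\qquad b(s,a)=\sqrt{\frac{2000\log(2S|\mathcal A|/\delta)}{N(s,a)}}.$$ Return a policy $\hat\pi$ with $\hat\pi(s)\in\arg\max_a\,\{\hat r(s,a)-b(s,a)\}$ for every $s$ (ties broken arbitrarily, possibly at random, in a measurable way). The algorithm uses only $\mathcal D$ and $\delta$; in particular it does not need to know $C^\star$. There is a universal constant $c>0$, independent of $\mathcal S,\mathcal A,\rho,R,\mu,\pi^\star,C^\star,N$ and the tie-breaking, such that the output $\hat\pi$ of CB-LCB with $\delta=1/N$ satisfies $$\mathbb E\big[J(\pi^\star)-J(\hat\pi)\big]\le c\,\min\left(1,\ \sqrt{\frac{S(C^\star-1)}{N}\,L}+\frac{S}{N}\,L\right),\qquad L=\log(2S|\mathcal A|N).$$ -/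

import Mathlib

open MeasureTheory ProbabilityTheory

noncomputable section

namespace OfflineCB

/-- A finite contextual bandit: an initial state distribution `ρ` on `S`, and for every
state-action pair a reward distribution on `[0,1]` (a Markov kernel). -/
structure ContextualBandit (S A : Type*) [MeasurableSpace S] [MeasurableSpace A] where
  /-- The distribution of the state (context). -/
  ρ : PMF S
  /-- The reward distributions. -/
  R : Kernel (S × A) unitInterval
  /-- Every `R (s, a)` is a probability distribution on `[0,1]`. -/
  markov : IsMarkovKernel R

attribute [instance] ContextualBandit.markov

/-- One observation `((s, a), r)`. -/
abbrev Sample (S A : Type*) := (S × A) × unitInterval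

/-- A batch dataset of size `N`. -/
abbrev Dataset (S A : Type*) (N : ℕ) := Fin N → Sample S A

namespace ContextualBandit

variable {S A : Type*} [MeasurableSpace S] [MeasurableSpace A]

/-- The expected reward `r(s,a)`. -/
def meanReward (B : ContextualBandit S A) (s : S) (a : A) : ℝ :=
  ∫ x, (x : ℝ) ∂(B.R (s, a))

/-- The value `V^π(s) = r(s, π(s))` of a deterministic policy (there are no transitions: the
discount factor is zero). -/
def value (B : ContextualBandit S A) (π : S → A) (s : S) : ℝ :=
  B.meanReward s (π s)

/-- The expected value `J(π) = ∑ₛ ρ(s) V^π(s)`. -/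
def J [Fintype S] (B : ContextualBandit S A) (π : S → A) : ℝ :=
  ∑ s, (B.ρ s).toReal * B.value π s

/-- `π` is an optimal policy: it maximizes the value in every state simultaneously. -/
def IsOptimal (B : ContextualBandit S A) (π : S → A) : Prop :=
  ∀ (π' : S → A) (s : S), B.value π' s ≤ B.value π s

/-- The concentrability coefficient `max_s ρ(s) / μ(s, π(s))`, computed in `[0, ∞]`: a state with
`μ(s, π(s)) = 0` contributes `∞` if `ρ(s) > 0`, and `0` if `ρ(s) = 0`. -/
def concentrability (B : ContextualBandit S A) (μ : PMF (S × A)) (π : S → A) : ENNReal :=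
  ⨆ s, B.ρ s / μ (s, π s)

/-- The law of one observation: `(s, a) ∼ μ`, then `r ∼ R(s, a)`. -/
def sampleLaw (B : ContextualBandit S A) (μ : PMF (S × A)) : Measure (Sample S A) :=
  μ.toMeasure.compProd B.R

end ContextualBandit

section Algorithm

variable {S A : Type*} [DecidableEq S] [DecidableEq A] {N : ℕ}

/-- `N(s,a)`, the number of observations of the pair `(s,a)`. -/
def count (D : Dataset S A N) (s : S) (a : A) : ℕ :=
  ∑ i, if (D i).1 = (s, a) then 1 else 0

/-- The empirical mean reward, set to `0` for an unobserved pair. -/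
def empReward (D : Dataset S A N) (s : S) (a : A) : ℝ :=
  if count D s a = 0 then 0
  else (1 / (count D s a : ℝ)) * ∑ i, if (D i).1 = (s, a) then ((D i).2 : ℝ) else 0

variable [Fintype S] [Fintype A]

/-- The penalty `b(s,a)` at confidence level `δ`, set to `1` for an unobserved pair. -/
def penalty (D : Dataset S A N) (δ : ℝ) (s : S) (a : A) : ℝ :=
  if count D s a = 0 then 1
  else Real.sqrt
    (2000 * Real.log (2 * (Fintype.card S : ℝ) * (Fintype.card A : ℝ) / δ) / (count D s a : ℝ))

/-- `π` is a possible output of CB-LCB on the dataset `D` at confidence level `δ`: in each state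
it picks an action that maximizes the lower confidence bound (ties are broken arbitrarily). -/
def IsLCBOutput (D : Dataset S A N) (δ : ℝ) (π : S → A) : Prop :=
  ∀ s a, empReward D s a - penalty D δ s a ≤ empReward D s (π s) - penalty D δ s (π s)

end Algorithm

end OfflineCB

end

/-! With δ = 1/N the logarithm in the penalty is exactly L. Write m(s) = μ(s, π⋆(s)) and m̄(s) for
the mass of the other actions at s, and call s well covered when N·m(s) ≥ 16000·L. A dataset is
typical (`IsTypical`) when each observed empirical mean is within a tenth of its penalty of the true
mean and, at well-covered states, the relevant counts are near their expectations. Chernoff bounds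
and a union bound give atypical datasets probability at most 1/N (`measure_not_isTypical_le`,
`failure_probability_le`).

On a typical dataset every score is a lower bound for the reward, so the regret at a well-covered
state is at most about the penalty of π⋆(s), of order √(L/(N·m)) (`IsTypical.gap_le`). Alone, this
only gives √(S·C⋆·L/N). The factor C⋆ - 1 comes from `IsTypical.eq_of_dominates`: if m̄(s) ≤
m(s)/10, the rival penalties are so much larger that the optimal action wins and the regret
vanishes.

For C⋆ ≤ 2, the remaining well-covered states have m < 10·m̄ and cost O(√(m̄·L/N)) each; since 1 =
Σρ ≤ C⋆·Σm, one has Σm̄ ≤ C⋆ - 1, and Cauchy–Schwarz concludes. Poorly covered states add O(S·L/N).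
For C⋆ ≥ 2, C⋆ and C⋆ - 1 are comparable and the simple bound suffices (`sum_mul_gap_le`). -/

open MeasureTheory ProbabilityTheory

noncomputable section

namespace OfflineCB

/-! ### Chernoff bounds for i.i.d. sums. -/

section Chernoff

variable {Ω X : Type*} [MeasurableSpace Ω] [MeasurableSpace X] {P : Measure Ω} {N : ℕ}

/-- An exponential moment of a sum of i.i.d. variables is a power. -/
lemma lintegral_exp_sum_eq_pow {ν : Measure X} {D : Fin N → Ω → X} [IsProbabilityMeasure P]
    (hind : iIndepFun D P) (hlaw : ∀ i, HasLaw (D i) ν P) {f : X → ℝ} (hf : Measurable f) :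
    ∫⁻ ω, ENNReal.ofReal (Real.exp (∑ i, f (D i ω))) ∂P =
      (∫⁻ x, ENNReal.ofReal (Real.exp (f x)) ∂ν) ^ N := by
  have hae : ∀ i, AEMeasurable (D i) P := fun i => (hlaw i).aemeasurable
  have hg : Measurable fun x => ENNReal.ofReal (Real.exp (f x)) := by fun_prop
  -- The law provides only a.e. measurability, so independence is transferred to measurable
  -- modifications.
  have hD : ∀ᵐ ω ∂P, ∀ i, D i ω = (hae i).mk (D i) ω := ae_all_iff.2 fun i => (hae i).ae_eq_mk
  have hind' := (hind.congr fun i => (hae i).ae_eq_mk).comp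
    (fun _ x => ENNReal.ofReal (Real.exp (f x))) fun _ => hg
  calc ∫⁻ ω, ENNReal.ofReal (Real.exp (∑ i, f (D i ω))) ∂P
      = ∫⁻ ω, ∏ i, ((fun x => ENNReal.ofReal (Real.exp (f x))) ∘ (hae i).mk (D i)) ω ∂P := by
        refine lintegral_congr_ae ?_
        filter_upwards [hD] with ω hω
        rw [Real.exp_sum, ENNReal.ofReal_prod_of_nonneg fun _ _ => (Real.exp_pos _).le]
        simp [hω]
    _ = ∏ i, ∫⁻ ω, ENNReal.ofReal (Real.exp (f ((hae i).mk (D i) ω))) ∂P :=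
        lintegral_prod_eq_prod_lintegral_of_indepFun _ _ hind' fun i =>
          hg.comp (hae i).measurable_mk
    _ = ∏ _i : Fin N, ∫⁻ x, ENNReal.ofReal (Real.exp (f x)) ∂ν := by
        refine Finset.prod_congr rfl fun i _ => ?_
        rw [← (hlaw i).lintegral_comp hg.aemeasurable]
        refine lintegral_congr_ae ?_
        filter_upwards [hD] with ω hω
        rw [hω i]
    _ = _ := by simp

/-- Chernoff's bound for sums of i.i.d. variables, from a bound on the exponential moment. -/
lemma measure_le_sum_le {ν : Measure X} {D : Fin N → Ω → X} [IsProbabilityMeasure P]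
    (hind : iIndepFun D P) (hlaw : ∀ i, HasLaw (D i) ν P) {f : X → ℝ} (hf : Measurable f)
    {κ : ℝ} (hκ : ∫⁻ x, ENNReal.ofReal (Real.exp (f x)) ∂ν ≤ ENNReal.ofReal (Real.exp κ)) (u : ℝ) :
    P {ω | u ≤ ∑ i, f (D i ω)} ≤ ENNReal.ofReal (Real.exp (N * κ - u)) := by
  have hae : ∀ i, AEMeasurable (D i) P := fun i => (hlaw i).aemeasurable
  have hF : AEMeasurable (fun ω => ENNReal.ofReal (Real.exp (∑ i, f (D i ω)))) P := by
    have : AEMeasurable (fun ω => ∑ i, f (D i ω)) P :=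
      Finset.aemeasurable_fun_sum _ fun i _ => hf.comp_aemeasurable (hae i)
    fun_prop
  have hset : {ω | u ≤ ∑ i, f (D i ω)} =
      {ω | ENNReal.ofReal (Real.exp u) ≤ ENNReal.ofReal (Real.exp (∑ i, f (D i ω)))} := by
    ext ω
    simp [ENNReal.ofReal_le_ofReal_iff (Real.exp_pos _).le]
  rw [hset]
  refine (meas_ge_le_lintegral_div hF (by simp [Real.exp_pos]) ENNReal.ofReal_ne_top).trans ?_
  rw [lintegral_exp_sum_eq_pow hind hlaw hf, Real.exp_sub, Real.exp_nat_mul,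
    ENNReal.ofReal_div_of_pos (Real.exp_pos _), ENNReal.ofReal_pow (Real.exp_pos _).le]
  gcongr

end Chernoff

/-! ### Exponential moments of one observation. -/

section ExpMoments

variable {S A : Type*} [Fintype S] [DecidableEq S] [MeasurableSpace S] [MeasurableSingletonClass S]
  [Fintype A] [DecidableEq A] [MeasurableSpace A] [MeasurableSingletonClass A]

lemma sum_toReal_pmf {X : Type*} [Fintype X] (p : PMF X) : ∑ x, (p x).toReal = 1 := by
  rw [← ENNReal.toReal_sum fun x _ => p.apply_ne_top x, ← tsum_fintype (L := .unconditional X),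
    p.tsum_coe, ENNReal.toReal_one]

lemma lintegral_sampleLaw (B : ContextualBandit S A) (μ : PMF (S × A)) {g : Sample S A → ENNReal}
    (hg : Measurable g) :
    ∫⁻ x, g x ∂(B.sampleLaw μ) = ∑ p, (∫⁻ r, g (p, r) ∂(B.R p)) * μ p := by
  rw [ContextualBandit.sampleLaw, Measure.lintegral_compProd hg, lintegral_fintype]
  simp

/-- The exponential moment of a multiple of the indicator of a set of pairs. -/
lemma lintegral_exp_indicator_le (B : ContextualBandit S A) (μ : PMF (S × A))
    (E : S × A → Prop) [DecidablePred E] (θ : ℝ) :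
    ∫⁻ x, ENNReal.ofReal (Real.exp (if E x.1 then θ else 0)) ∂(B.sampleLaw μ) ≤
      ENNReal.ofReal (Real.exp
        ((Real.exp θ - 1) * ∑ p, if E p then (μ p).toReal else 0)) := by
  have hm : Measurable fun x : Sample S A => ENNReal.ofReal (Real.exp (if E x.1 then θ else 0)) :=
    (measurable_of_finite fun p : S × A =>
      ENNReal.ofReal (Real.exp (if E p then θ else 0))).comp measurable_fst
  rw [lintegral_sampleLaw B μ hm]
  have h : ∀ p, (∫⁻ _r, ENNReal.ofReal (Real.exp (if E p then θ else 0)) ∂(B.R p)) * μ p =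
      ENNReal.ofReal (Real.exp (if E p then θ else 0) * (μ p).toReal) := fun p => by
    rw [lintegral_const, measure_univ, mul_one, ENNReal.ofReal_mul (Real.exp_pos _).le,
      ENNReal.ofReal_toReal (μ.apply_ne_top p)]
  simp only [h]
  rw [← ENNReal.ofReal_sum_of_nonneg fun p _ => by positivity]
  refine ENNReal.ofReal_le_ofReal ?_
  have key : ∑ p, Real.exp (if E p then θ else 0) * (μ p).toReal =
      (Real.exp θ - 1) * (∑ p, if E p then (μ p).toReal else 0) + ∑ p, (μ p).toReal := by
    rw [Finset.mul_sum, ← Finset.sum_add_distrib]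
    refine Finset.sum_congr rfl fun p _ => ?_
    split_ifs
    · ring
    · rw [Real.exp_zero]; ring
  rw [key, sum_toReal_pmf]
  exact Real.add_one_le_exp _

/-- The self-normalized exponential moment of a centred reward (Hoeffding's lemma). -/
lemma lintegral_exp_reward_le (B : ContextualBandit S A) (μ : PMF (S × A)) (s : S) (a : A)
    (lam : ℝ) :
    ∫⁻ x, ENNReal.ofReal (Real.exp (if x.1 = (s, a) then
      lam * ((x.2 : ℝ) - B.meanReward s a) - lam ^ 2 / 8 else 0)) ∂(B.sampleLaw μ) ≤
      ENNReal.ofReal (Real.exp 0) := by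
  have hm : Measurable fun x : Sample S A => ENNReal.ofReal (Real.exp (if x.1 = (s, a) then
      lam * ((x.2 : ℝ) - B.meanReward s a) - lam ^ 2 / 8 else 0)) := by
    refine (Real.measurable_exp.comp (Measurable.ite ?_ ?_ measurable_const)).ennreal_ofReal
    · exact measurable_fst (measurableSet_singleton (s, a))
    · have : Measurable fun x : Sample S A => (x.2 : ℝ) := measurable_subtype_coe.comp measurable_snd
      fun_prop
  rw [lintegral_sampleLaw B μ hm]
  have hsum : ENNReal.ofReal (Real.exp 0) = ∑ p, 1 * μ p := by
    rw [Real.exp_zero, ENNReal.ofReal_one]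
    simp only [one_mul]
    rw [← tsum_fintype (L := .unconditional (S × A)), μ.tsum_coe]
  rw [hsum]
  -- Each pair contributes at most its mass: the integrand is 1 away from (s, a), and at (s, a) the
  -- term -lam²/8 cancels Hoeffding's bound.
  refine Finset.sum_le_sum fun p _ => ?_
  gcongr
  by_cases hp : p = (s, a)
  · subst hp
    have hsub : HasSubgaussianMGF (fun r : unitInterval => (r : ℝ) - B.meanReward s a)
        ((‖(1 : ℝ) - 0‖₊ / 2) ^ 2) (B.R (s, a)) :=
      hasSubgaussianMGF_of_mem_Icc (X := fun r : unitInterval => (r : ℝ))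
        measurable_subtype_coe.aemeasurable (.of_forall fun r => r.2)
    have hmgf := hsub.mgf_le lam
    have hint := hsub.integrable_exp_mul lam
    simp only [if_true]
    have heq : ∀ r : unitInterval,
        Real.exp (lam * ((r : ℝ) - B.meanReward s a) - lam ^ 2 / 8) =
          Real.exp (lam * ((r : ℝ) - B.meanReward s a)) * Real.exp (-(lam ^ 2 / 8)) := fun r => by
      rw [← Real.exp_add]; ring_nf
    simp only [heq]
    rw [← ofReal_integral_eq_lintegral_ofReal (hint.mul_const _)
      (.of_forall fun r => by positivity), ← ENNReal.ofReal_one]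
    refine ENNReal.ofReal_le_ofReal ?_
    rw [integral_mul_const]
    calc _ ≤ Real.exp (lam ^ 2 / 8) * Real.exp (-(lam ^ 2 / 8)) := by
          gcongr
          refine hmgf.trans (Real.exp_le_exp.2 (le_of_eq ?_))
          norm_num
          ring
      _ = 1 := by rw [← Real.exp_add]; simp
  · simp [hp]

end ExpMoments


/-! ### Deterministic summation of the regret over states. -/

section Regret

variable {S : Type*} [Fintype S]

lemma sum_sqrt_le_sqrt_card_mul_sum {x : S → ℝ} (hx : ∀ s, 0 ≤ x s) :
    ∑ s, Real.sqrt (x s) ≤ Real.sqrt (Fintype.card S * ∑ s, x s) := by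
  refine Real.le_sqrt_of_sq_le ?_
  have h := sq_sum_le_card_mul_sum_sq (s := (Finset.univ : Finset S)) (f := fun s => Real.sqrt (x s))
  simpa [Real.sq_sqrt (hx _)] using h

/-- The regret bound when the concentrability is close to `1`: the states where the optimal
action dominates the data contribute nothing. -/
lemma sum_mul_gap_le_of_le_two {ρ m mbar gap : S → ℝ} {C L N : ℝ}
    (hρ1 : ∑ s, ρ s = 1) (hm : ∀ s, 0 ≤ m s) (hbar : ∀ s, 0 ≤ mbar s)
    (htot : ∑ s, m s + ∑ s, mbar s = 1) (hC : 1 ≤ C) (hC2 : C ≤ 2) (hL : 0 < L) (hN : 0 < N)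
    (hρm : ∀ s, ρ s ≤ C * m s) (hρ : ∀ s, 0 ≤ ρ s) (hgap0 : ∀ s, 0 ≤ gap s) (hgap1 : ∀ s, gap s ≤ 1)
    (hgap : ∀ s, 16000 * L ≤ N * m s → gap s ≤ 150 * Real.sqrt (L / (N * m s)))
    (hzero : ∀ s, 16000 * L ≤ N * m s → 10 * mbar s ≤ m s → gap s = 0) :
    ∑ s, ρ s * gap s ≤ 1000 * Real.sqrt (Fintype.card S * (C - 1) / N * L) +
      32000 * (Fintype.card S / N * L) := by
  have hs : ∀ s, ρ s * gap s ≤ 32000 * L / N + 1000 * Real.sqrt (mbar s * L / N) := by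
    intro s
    have hsq := Real.sqrt_nonneg (mbar s * L / N)
    have hLN : 0 < 32000 * L / N := by positivity
    have hρ2 : ρ s ≤ 2 * m s := (hρm s).trans (mul_le_mul_of_nonneg_right hC2 (hm s))
    rcases lt_or_ge (N * m s) (16000 * L) with h | h
    · have h1 : ρ s * gap s ≤ ρ s := mul_le_of_le_one_right (hρ s) (hgap1 s)
      have h2 : m s ≤ 16000 * L / N := by
        rw [le_div_iff₀ hN]; linarith
      have h3 : 32000 * L / N = 2 * (16000 * L / N) := by ring
      linarith
    rcases le_or_gt (10 * mbar s) (m s) with hd | hd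
    · rw [hzero s h hd, mul_zero]; positivity
    have hmpos : 0 < m s := by
      by_contra hcon
      have : N * m s ≤ 0 := mul_nonpos_of_nonneg_of_nonpos hN.le (not_lt.1 hcon)
      linarith
    have h1 : ρ s * gap s ≤ 2 * m s * (150 * Real.sqrt (L / (N * m s))) :=
      mul_le_mul hρ2 (hgap s h) (hgap0 s) (by positivity)
    have h2 : m s * Real.sqrt (L / (N * m s)) = Real.sqrt (m s * L / N) := by
      rw [← Real.sqrt_sq hmpos.le, ← Real.sqrt_mul (sq_nonneg _), Real.sqrt_sq hmpos.le]
      congr 1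
      field_simp
    -- Here m < 10·m̄, and 3.2² ≥ 10.
    have h3 : Real.sqrt (m s * L / N) ≤ 3.2 * Real.sqrt (mbar s * L / N) := by
      rw [← Real.sqrt_sq (show (0 : ℝ) ≤ 3.2 by norm_num), ← Real.sqrt_mul (sq_nonneg _)]
      refine Real.sqrt_le_sqrt ?_
      rw [← mul_div_assoc]
      gcongr ?_ / N
      rw [← mul_assoc]
      gcongr ?_ * L
      have := hbar s
      linarith
    nlinarith
  -- From 1 ≤ C·Σm and Σm ≤ 1: Σm̄ = 1 - Σm ≤ (C - 1)·Σm ≤ C - 1.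
  have hmsum : ∑ s, mbar s ≤ C - 1 := by
    have h1 : 1 ≤ C * ∑ s, m s := by
      rw [← hρ1, Finset.mul_sum]
      exact Finset.sum_le_sum fun s _ => hρm s
    have h2 : ∑ s, m s ≤ 1 := by
      have := Finset.sum_nonneg fun s (_ : s ∈ Finset.univ) => hbar s
      linarith
    nlinarith
  calc ∑ s, ρ s * gap s ≤ ∑ s, (32000 * L / N + 1000 * Real.sqrt (mbar s * L / N)) :=
        Finset.sum_le_sum fun s _ => hs s
    _ = 1000 * ∑ s, Real.sqrt (mbar s * L / N) + 32000 * (Fintype.card S / N * L) := by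
        rw [Finset.sum_add_distrib, ← Finset.mul_sum]
        simp
        ring
    _ ≤ _ := by
        gcongr
        refine (sum_sqrt_le_sqrt_card_mul_sum fun s => ?_).trans (Real.sqrt_le_sqrt ?_)
        · have := hbar s
          positivity
        · have : ∑ s, mbar s * L / N = (∑ s, mbar s) * (L / N) := by
            rw [Finset.sum_mul]
            exact Finset.sum_congr rfl fun s _ => by ring
          rw [this]
          calc (Fintype.card S : ℝ) * ((∑ s, mbar s) * (L / N))
              ≤ Fintype.card S * ((C - 1) * (L / N)) := by gcongr
            _ = _ := by ring

/-- The regret bound when the concentrability is at least `2`. -/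
lemma sum_mul_gap_le_of_two_le {ρ m gap : S → ℝ} {C L N : ℝ}
    (hρ1 : ∑ s, ρ s = 1) (hC2 : 2 ≤ C) (hL : 0 < L) (hN : 0 < N)
    (hρm : ∀ s, ρ s ≤ C * m s) (hρ : ∀ s, 0 ≤ ρ s) (hgap1 : ∀ s, gap s ≤ 1)
    (hgap : ∀ s, 16000 * L ≤ N * m s → gap s ≤ 150 * Real.sqrt (L / (N * m s))) :
    ∑ s, ρ s * gap s ≤ 32300 * Real.sqrt (Fintype.card S * (C - 1) / N * L) := by
  have hs : ∀ s, ρ s * gap s ≤ 16000 * (C * L / N) + 150 * Real.sqrt (ρ s * (C * L / N)) := by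
    intro s
    have hρs := hρ s
    have hsq := Real.sqrt_nonneg (ρ s * (C * L / N))
    have hCL : 0 ≤ C * L / N := by positivity
    rcases lt_or_ge (N * m s) (16000 * L) with h | h
    · have h1 : ρ s * gap s ≤ ρ s := mul_le_of_le_one_right (hρ s) (hgap1 s)
      have h2 : m s ≤ 16000 * L / N := by
        rw [le_div_iff₀ hN]; linarith
      have h3 : C * m s ≤ C * (16000 * L / N) := by gcongr
      have h4 : C * (16000 * L / N) = 16000 * (C * L / N) := by ring
      linarith [hρm s]
    have hmpos : 0 < m s := by
      by_contra hcon
      have : N * m s ≤ 0 := mul_nonpos_of_nonneg_of_nonpos hN.le (not_lt.1 hcon)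
      linarith
    have h1 : ρ s * gap s ≤ ρ s * (150 * Real.sqrt (L / (N * m s))) := by
      gcongr
      exact hgap s h
    have h2 : ρ s * Real.sqrt (L / (N * m s)) ≤ Real.sqrt (ρ s * (C * L / N)) := by
      rw [← Real.sqrt_sq hρs, ← Real.sqrt_mul (sq_nonneg _), Real.sqrt_sq hρs]
      refine Real.sqrt_le_sqrt ?_
      calc ρ s ^ 2 * (L / (N * m s)) = ρ s * ρ s * (L / (N * m s)) := by ring
        _ ≤ ρ s * (C * m s) * (L / (N * m s)) := by
          gcongr
          exact hρm s
        _ = _ := by field_simp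
    linarith
  set x : ℝ := Fintype.card S * (C * L / N) with hx
  set y : ℝ := Fintype.card S * (C - 1) / N * L with hy
  have hx0 : 0 ≤ x := by positivity
  have hxy : x ≤ 4 * y := by
    calc x ≤ Fintype.card S * ((4 * (C - 1)) * L / N) := by
          rw [hx]; gcongr; linarith
      _ = 4 * y := by rw [hy]; ring
  have hsxy : Real.sqrt x ≤ 2 * Real.sqrt y := by
    rw [← Real.sqrt_sq (show (0 : ℝ) ≤ 2 by norm_num), ← Real.sqrt_mul (sq_nonneg _)]
    exact Real.sqrt_le_sqrt (by linarith)
  have hone : ∑ s, ρ s * gap s ≤ 1 := by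
    rw [← hρ1]
    exact Finset.sum_le_sum fun s _ => mul_le_of_le_one_right (hρ s) (hgap1 s)
  -- The poorly covered states contribute a term linear in x, absorbed by √x when x ≤ 1; for x > 1
  -- the trivial bound 1 ≤ √x is enough.
  rcases le_or_gt x 1 with h1 | h1
  · have hxs : x ≤ Real.sqrt x := by
      refine Real.le_sqrt_of_sq_le ?_
      nlinarith
    have htot : ∑ s, ρ s * gap s ≤ 16000 * x + 150 * Real.sqrt x := by
      calc ∑ s, ρ s * gap s ≤ ∑ s, (16000 * (C * L / N) + 150 * Real.sqrt (ρ s * (C * L / N))) :=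
            Finset.sum_le_sum fun s _ => hs s
        _ = 16000 * x + 150 * ∑ s, Real.sqrt (ρ s * (C * L / N)) := by
            rw [Finset.sum_add_distrib, ← Finset.mul_sum, ← Finset.mul_sum, hx]
            simp
        _ ≤ _ := by
            gcongr
            refine (sum_sqrt_le_sqrt_card_mul_sum fun s => ?_).trans (Real.sqrt_le_sqrt ?_)
            · have := hρ s
              positivity
            · rw [← Finset.sum_mul, hρ1, one_mul]
    linarith
  · have : 1 ≤ Real.sqrt x := Real.one_le_sqrt.2 h1.le
    have := Real.sqrt_nonneg y
    linarith

/-- Summation of the per-state regret over the states, for every concentrability `C ≥ 1`. -/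
lemma sum_mul_gap_le {ρ m mbar gap : S → ℝ} {C L N : ℝ}
    (hρ1 : ∑ s, ρ s = 1) (hm : ∀ s, 0 ≤ m s) (hbar : ∀ s, 0 ≤ mbar s)
    (htot : ∑ s, m s + ∑ s, mbar s = 1) (hC : 1 ≤ C) (hL : 0 < L) (hN : 0 < N)
    (hρm : ∀ s, ρ s ≤ C * m s) (hρ : ∀ s, 0 ≤ ρ s) (hgap0 : ∀ s, 0 ≤ gap s) (hgap1 : ∀ s, gap s ≤ 1)
    (hgap : ∀ s, 16000 * L ≤ N * m s → gap s ≤ 150 * Real.sqrt (L / (N * m s)))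
    (hzero : ∀ s, 16000 * L ≤ N * m s → 10 * mbar s ≤ m s → gap s = 0) :
    ∑ s, ρ s * gap s ≤ 32300 * Real.sqrt (Fintype.card S * (C - 1) / N * L) +
      32000 * (Fintype.card S / N * L) := by
  have h1 : 0 ≤ Real.sqrt (Fintype.card S * (C - 1) / N * L) := Real.sqrt_nonneg _
  have h2 : 0 ≤ Fintype.card S / N * L := by positivity
  rcases le_total C 2 with h | h
  · have := sum_mul_gap_le_of_le_two hρ1 hm hbar htot hC h hL hN hρm hρ hgap0 hgap1 hgap hzero
    linarith
  · have := sum_mul_gap_le_of_two_le hρ1 h hL hN hρm hρ hgap1 hgap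
    linarith

end Regret

/-! ### Elementary bounds on rewards and penalties. -/

section MeanReward

variable {S A : Type*} [MeasurableSpace S] [MeasurableSpace A]

lemma meanReward_nonneg (B : ContextualBandit S A) (s : S) (a : A) : 0 ≤ B.meanReward s a :=
  integral_nonneg fun r => r.2.1

lemma meanReward_le_one (B : ContextualBandit S A) (s : S) (a : A) : B.meanReward s a ≤ 1 := by
  have h : ∫ r : unitInterval, (r : ℝ) ∂(B.R (s, a)) ≤ ∫ _r : unitInterval, (1 : ℝ) ∂(B.R (s, a)) :=
    integral_mono_of_nonneg (.of_forall fun r => r.2.1) (integrable_const _)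
      (.of_forall fun r => r.2.2)
  simpa [ContextualBandit.meanReward] using h

end MeanReward

section Penalty

variable {S A : Type*} [Fintype S] [DecidableEq S] [Fintype A] [DecidableEq A] {N : ℕ}

lemma penalty_eq {D : Dataset S A N} {δ L : ℝ}
    (hL : L = Real.log (2 * (Fintype.card S : ℝ) * (Fintype.card A : ℝ) / δ)) {s : S} {a : A}
    (h : count D s a ≠ 0) : penalty D δ s a = Real.sqrt (2000 * L / count D s a) := by
  rw [penalty, if_neg h, hL]

end Penalty

/-! ### Behaviour of CB-LCB on a typical dataset. -/

section Typical

variable {S A : Type*} [DecidableEq S] [MeasurableSpace S] [DecidableEq A] [MeasurableSpace A]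
  {N : ℕ}

/-- A dataset whose empirical rewards and counts are close to their means. -/
structure IsTypical (B : ContextualBandit S A) (μ : PMF (S × A)) (πstar : S → A)
    (D : Dataset S A N) (L : ℝ) : Prop where
  reward : ∀ s a, count D s a ≠ 0 →
    |empReward D s a - B.meanReward s a| ≤ Real.sqrt (2000 * L / count D s a) / 10
  count_ge : ∀ s, 16000 * L ≤ N * (μ (s, πstar s)).toReal →
    N * (μ (s, πstar s)).toReal / 2 ≤ count D s (πstar s)
  count_le : ∀ s a, 16000 * L ≤ N * (μ (s, πstar s)).toReal →
    10 * (μ (s, a)).toReal ≤ (μ (s, πstar s)).toReal →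
    (count D s a : ℝ) ≤ N * (μ (s, πstar s)).toReal / 4

variable {B : ContextualBandit S A} {μ : PMF (S × A)} {πstar π : S → A} {D : Dataset S A N}
  {δ L : ℝ}

namespace IsTypical

lemma count_ne_zero (h : IsTypical B μ πstar D L) (hLpos : 0 < L) {s : S}
    (hs : 16000 * L ≤ N * (μ (s, πstar s)).toReal) : count D s (πstar s) ≠ 0 := by
  intro hc
  have := h.count_ge s hs
  rw [hc, Nat.cast_zero] at this
  linarith

lemma sqrt_count_le (h : IsTypical B μ πstar D L) (hLpos : 0 < L)
    {s : S} (hs : 16000 * L ≤ N * (μ (s, πstar s)).toReal) :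
    Real.sqrt (2000 * L / count D s (πstar s)) ≤
      Real.sqrt (4000 * (L / (N * (μ (s, πstar s)).toReal))) := by
  refine Real.sqrt_le_sqrt ?_
  have hpos : 0 < N * (μ (s, πstar s)).toReal := by linarith
  calc 2000 * L / count D s (πstar s) ≤ 2000 * L / (N * (μ (s, πstar s)).toReal / 2) := by
        gcongr
        exact h.count_ge s hs
    _ = _ := by field_simp; norm_num

variable [Fintype S] [Fintype A]

/-- Pessimism is valid: the deviation is below the penalty, and an unobserved pair has score 0 - 1 =
-1. -/
lemma lcb_le (h : IsTypical B μ πstar D L)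
    (hL : L = Real.log (2 * (Fintype.card S : ℝ) * (Fintype.card A : ℝ) / δ)) (s : S) (a : A) :
    empReward D s a - penalty D δ s a ≤ B.meanReward s a := by
  by_cases hc : count D s a = 0
  · have := meanReward_nonneg B s a
    simp only [empReward, penalty, hc, if_true]
    linarith
  · have h1 := abs_le.1 (h.reward s a hc)
    rw [penalty_eq hL hc]
    have := Real.sqrt_nonneg (2000 * L / count D s a)
    linarith

lemma le_lcb (h : IsTypical B μ πstar D L)
    (hL : L = Real.log (2 * (Fintype.card S : ℝ) * (Fintype.card A : ℝ) / δ)) (hLpos : 0 < L)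
    {s : S} (hs : 16000 * L ≤ N * (μ (s, πstar s)).toReal) :
    B.meanReward s (πstar s) - 1.1 * Real.sqrt (2000 * L / count D s (πstar s)) ≤
      empReward D s (πstar s) - penalty D δ s (πstar s) := by
  have hc := h.count_ne_zero hLpos hs
  have h1 := abs_le.1 (h.reward s _ hc)
  rw [penalty_eq hL hc]
  linarith

/-- On a typical dataset the regret in a well-covered state is of the order of the penalty. -/
lemma gap_le (h : IsTypical B μ πstar D L)
    (hL : L = Real.log (2 * (Fintype.card S : ℝ) * (Fintype.card A : ℝ) / δ)) (hLpos : 0 < L)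
    (hπ : IsLCBOutput D δ π) {s : S} (hs : 16000 * L ≤ N * (μ (s, πstar s)).toReal) :
    B.meanReward s (πstar s) - B.meanReward s (π s) ≤
      150 * Real.sqrt (L / (N * (μ (s, πstar s)).toReal)) := by
  have h1 := h.lcb_le hL s (π s)
  have h2 := hπ s (πstar s)
  have h3 := h.le_lcb hL hLpos hs
  have h4 := h.sqrt_count_le hLpos hs
  -- 64² ≥ 4000, and 1.1·64 ≤ 150.
  have h5 : Real.sqrt (4000 * (L / (N * (μ (s, πstar s)).toReal))) ≤
      64 * Real.sqrt (L / (N * (μ (s, πstar s)).toReal)) := by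
    rw [Real.sqrt_mul (by norm_num)]
    gcongr
    rw [Real.sqrt_le_left (by norm_num)]
    norm_num
  have := Real.sqrt_nonneg (L / (N * (μ (s, πstar s)).toReal))
  linarith

/-- On a typical dataset the optimal action is selected in a well-covered state in which it
dominates the data. -/
lemma eq_of_dominates (h : IsTypical B μ πstar D L) (hopt : B.IsOptimal πstar)
    (hL : L = Real.log (2 * (Fintype.card S : ℝ) * (Fintype.card A : ℝ) / δ)) (hLpos : 0 < L)
    (hπ : IsLCBOutput D δ π) {s : S} (hs : 16000 * L ≤ N * (μ (s, πstar s)).toReal)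
    (hdom : ∀ a, a ≠ πstar s → 10 * (μ (s, a)).toReal ≤ (μ (s, πstar s)).toReal) :
    π s = πstar s := by
  by_contra hne
  have h2 := hπ s (πstar s)
  have h3 := h.le_lcb hL hLpos hs
  have hcs := h.count_ne_zero hLpos hs
  have hcspos : (0 : ℝ) < count D s (πstar s) := by exact_mod_cast Nat.pos_of_ne_zero hcs
  have hge := h.count_ge s hs
  set bs := Real.sqrt (2000 * L / count D s (πstar s)) with hbs
  by_cases hc : count D s (π s) = 0
  -- An unobserved rival scores -1. The threshold 16000·L forces count ≥ 8000·L, so the optimal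
  -- action scores at least -1.1/2 > -1.
  · have h5 : bs ≤ 1 / 2 := by
      rw [hbs, Real.sqrt_le_left (by norm_num), div_le_iff₀ hcspos]
      linarith
    have := meanReward_nonneg B s (πstar s)
    have h6 : empReward D s (π s) - penalty D δ s (π s) = -1 := by
      simp [empReward, penalty, hc]
    linarith
  · have hcpos : (0 : ℝ) < count D s (π s) := by exact_mod_cast Nat.pos_of_ne_zero hc
    have h1 := abs_le.1 (h.reward s _ hc)
    rw [penalty_eq hL hc] at h2
    have hle := h.count_le s (π s) hs (hdom _ hne)
    have hbspos : 0 < bs := Real.sqrt_pos.2 (by positivity)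
    -- The rival has at most half as many samples and 1.4² ≤ 2. Its score is at most its mean minus
    -- 0.9·1.4·bs = 1.26·bs, below the optimal score, which loses at most 1.1·bs.
    have h5 : 1.4 * bs ≤ Real.sqrt (2000 * L / count D s (π s)) := by
      rw [hbs, ← Real.sqrt_sq (show (0 : ℝ) ≤ 1.4 by norm_num), ← Real.sqrt_mul (sq_nonneg _)]
      refine Real.sqrt_le_sqrt ?_
      rw [mul_div_assoc', div_le_div_iff₀ hcspos hcpos]
      have : (count D s (π s) : ℝ) ≤ count D s (πstar s) / 2 := by linarith
      nlinarith
    have h6 : B.meanReward s (π s) ≤ B.meanReward s (πstar s) := hopt π s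
    linarith

end IsTypical

end Typical


/-! ### Counts and empirical means as sums over the sample. -/

section Counts

variable {S A : Type*} [DecidableEq S] [DecidableEq A] {N : ℕ}

lemma count_le (D : Dataset S A N) (s : S) (a : A) : count D s a ≤ N := by
  have h := Finset.sum_le_sum (s := Finset.univ) fun (i : Fin N) _ =>
    (by split_ifs <;> simp : (if (D i).1 = (s, a) then 1 else 0) ≤ 1)
  simpa [count] using h

lemma sum_ite_eq_mul_count (D : Dataset S A N) (s : S) (a : A) (θ : ℝ) :
    ∑ i, (if (D i).1 = (s, a) then θ else 0) = θ * count D s a := by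
  rw [count, Nat.cast_sum, Finset.mul_sum]
  exact Finset.sum_congr rfl fun i _ => by split_ifs <;> simp

lemma sum_ite_reward_eq (D : Dataset S A N) (s : S) (a : A) (lam m : ℝ) (h : count D s a ≠ 0) :
    ∑ i, (if (D i).1 = (s, a) then lam * (((D i).2 : ℝ) - m) - lam ^ 2 / 8 else 0) =
      count D s a * (lam * (empReward D s a - m) - lam ^ 2 / 8) := by
  have hc : (count D s a : ℝ) ≠ 0 := by exact_mod_cast h
  have h1 : ∀ i, (if (D i).1 = (s, a) then lam * (((D i).2 : ℝ) - m) - lam ^ 2 / 8 else 0) =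
      lam * (if (D i).1 = (s, a) then ((D i).2 : ℝ) else 0) +
        (if (D i).1 = (s, a) then -(lam * m) - lam ^ 2 / 8 else 0) := fun i => by
    split_ifs <;> ring
  rw [Finset.sum_congr rfl fun i _ => h1 i, Finset.sum_add_distrib, ← Finset.mul_sum,
    sum_ite_eq_mul_count, empReward, if_neg h]
  field_simp
  ring

/-- Control of the two self-normalized exponents with the parameters `± 0.4 √(2000 L / n)`
controls the deviation of the empirical reward. -/
lemma abs_empReward_sub_le (D : Dataset S A N) (s : S) (a : A) {L m : ℝ} (hL : 0 < L)
    (h : count D s a ≠ 0)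
    (hdev : ∀ σ : ℝ, σ = 1 ∨ σ = -1 →
      ∑ i, (if (D i).1 = (s, a) then
        σ * (0.4 * Real.sqrt (2000 * L / count D s a)) * (((D i).2 : ℝ) - m) -
          (σ * (0.4 * Real.sqrt (2000 * L / count D s a))) ^ 2 / 8 else 0) < 40 * L) :
    |empReward D s a - m| ≤ Real.sqrt (2000 * L / count D s a) / 10 := by
  have hc : (0 : ℝ) < count D s a := by exact_mod_cast Nat.pos_of_ne_zero h
  have h1 := hdev 1 (Or.inl rfl)
  have h2 := hdev (-1) (Or.inr rfl)
  rw [sum_ite_reward_eq D s a _ m h] at h1 h2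
  set b := Real.sqrt (2000 * L / count D s a) with hb
  have hbpos : 0 < b := Real.sqrt_pos.2 (by positivity)
  -- With n the count and parameter 0.4·b, the quadratic term is n·(0.4·b)²/8 = 40·L, equal to the
  -- allowed level; hence 0.4·n·b·|dev| < 80·L, that is n·b·|dev| < n·b²/10.
  have hbsq : count D s a * b ^ 2 = 2000 * L := by
    rw [hb, Real.sq_sqrt (by positivity)]
    field_simp
  have hcb : 0 < count D s a * b := by positivity
  refine abs_le.2 ⟨?_, ?_⟩
  · refine le_of_mul_le_mul_left ?_ hcb
    nlinarith
  · refine le_of_mul_le_mul_left ?_ hcb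
    nlinarith

end Counts

/-! ### Concentration and the union bound. -/

section Concentration

variable {S A : Type*} [Fintype S] [DecidableEq S] [MeasurableSpace S] [MeasurableSingletonClass S]
  [Fintype A] [DecidableEq A] [MeasurableSpace A] [MeasurableSingletonClass A]
  {B : ContextualBandit S A} {μ : PMF (S × A)} {N : ℕ}
  {Ω : Type*} [MeasurableSpace Ω] {P : Measure Ω} [IsProbabilityMeasure P]
  {D : Fin N → Ω → Sample S A}

lemma measure_reward_deviation_le (hind : iIndepFun D P)
    (hlaw : ∀ i, HasLaw (D i) (B.sampleLaw μ) P) (s : S) (a : A) (lam u : ℝ) :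
    P {ω | u ≤ ∑ i, (if (D i ω).1 = (s, a) then
      lam * (((D i ω).2 : ℝ) - B.meanReward s a) - lam ^ 2 / 8 else 0)} ≤
      ENNReal.ofReal (Real.exp (-u)) := by
  have hm : Measurable fun x : Sample S A => if x.1 = (s, a) then
      lam * ((x.2 : ℝ) - B.meanReward s a) - lam ^ 2 / 8 else 0 := by
    refine Measurable.ite ?_ ?_ measurable_const
    · exact measurable_fst (measurableSet_singleton (s, a))
    · have : Measurable fun x : Sample S A => (x.2 : ℝ) := measurable_subtype_coe.comp measurable_snd
      fun_prop
  simpa using measure_le_sum_le hind hlaw hm (lintegral_exp_reward_le B μ s a lam) u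

lemma measure_le_mul_count_le (hind : iIndepFun D P)
    (hlaw : ∀ i, HasLaw (D i) (B.sampleLaw μ) P) (s : S) (a : A) (θ u : ℝ) :
    P {ω | u ≤ θ * count (fun i => D i ω) s a} ≤
      ENNReal.ofReal (Real.exp (N * ((Real.exp θ - 1) * (μ (s, a)).toReal) - u)) := by
  have hm : Measurable fun x : Sample S A => if x.1 = (s, a) then θ else 0 :=
    Measurable.ite (measurable_fst (measurableSet_singleton (s, a))) measurable_const
      measurable_const
  have h := measure_le_sum_le hind hlaw hm
    (lintegral_exp_indicator_le B μ (fun p => p = (s, a)) θ) u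
  simpa [← sum_ite_eq_mul_count] using h

lemma measure_count_lt_le (hind : iIndepFun D P)
    (hlaw : ∀ i, HasLaw (D i) (B.sampleLaw μ) P) (s : S) (a : A) {L : ℝ}
    (h : 16000 * L ≤ N * (μ (s, a)).toReal) :
    P {ω | (count (fun i => D i ω) s a : ℝ) < N * (μ (s, a)).toReal / 2} ≤
      ENNReal.ofReal (Real.exp (-(40 * L))) := by
  have hx : 0 ≤ N * (μ (s, a)).toReal := by positivity
  refine (measure_mono fun ω hω => ?_).trans
    ((measure_le_mul_count_le hind hlaw s a (-1) (-(N * (μ (s, a)).toReal / 2))).trans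
      (ENNReal.ofReal_le_ofReal (Real.exp_le_exp.2 ?_)))
  · simp only [Set.mem_ofPred_eq] at hω ⊢
    linarith
  -- The exponent is N·μ·(e⁻¹ - 1/2), and 16000·(1/2 - e⁻¹) > 40.
  · have := Real.exp_neg_one_lt_d9
    nlinarith

lemma measure_lt_count_le (hind : iIndepFun D P)
    (hlaw : ∀ i, HasLaw (D i) (B.sampleLaw μ) P) (s : S) (a : A) {L x : ℝ}
    (h : 16000 * L ≤ N * x) (hx0 : 0 ≤ x) (hx : 10 * (μ (s, a)).toReal ≤ x) :
    P {ω | N * x / 4 < (count (fun i => D i ω) s a : ℝ)} ≤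
      ENNReal.ofReal (Real.exp (-(40 * L))) := by
  have hNx : 0 ≤ N * x := by positivity
  refine (measure_mono fun ω hω => ?_).trans
    ((measure_le_mul_count_le hind hlaw s a 1 (N * x / 4)).trans
      (ENNReal.ofReal_le_ofReal (Real.exp_le_exp.2 ?_)))
  · simp only [Set.mem_ofPred_eq] at hω ⊢
    linarith
  -- Since μ ≤ x/10, the exponent is at most N·x·((e - 1)/10 - 1/4), and the bracket is below -0.07.
  · have h1 := Real.exp_one_lt_d9
    have h2 : N * (10 * (μ (s, a)).toReal) ≤ N * x := by gcongr
    have h3 : 0 ≤ N * (μ (s, a)).toReal := by positivity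
    nlinarith

/-- A dataset is atypical with exponentially small probability. -/
lemma measure_not_isTypical_le (hind : iIndepFun D P)
    (hlaw : ∀ i, HasLaw (D i) (B.sampleLaw μ) P) (πstar : S → A) {L : ℝ} (hL : 0 < L) :
    P {ω | ¬ IsTypical B μ πstar (fun i => D i ω) L} ≤
      ENNReal.ofReal ((2 * (Fintype.card S * Fintype.card A * N) + Fintype.card S +
        Fintype.card S * Fintype.card A) * Real.exp (-(40 * L))) := by
  classical
  set e := ENNReal.ofReal (Real.exp (-(40 * L))) with he
  set lam : ℕ → ℝ := fun n => 0.4 * Real.sqrt (2000 * L / n) with hlam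
  -- The right parameter depends on the random count, so the union runs over its possible values 1,
  -- …, N (hence the shift `q.2.1 + 1`) and both signs; no conditioning on the counts is needed.
  set R : (S × A) × Fin N × Bool → Set Ω := fun q =>
    {ω | 40 * L ≤ ∑ i, (if (D i ω).1 = (q.1.1, q.1.2) then
      (if q.2.2 then 1 else -1) * lam (q.2.1 + 1) * (((D i ω).2 : ℝ) - B.meanReward q.1.1 q.1.2) -
        ((if q.2.2 then 1 else -1) * lam (q.2.1 + 1)) ^ 2 / 8 else 0)} with hR
  set G : S → Set Ω := fun s => {ω | 16000 * L ≤ N * (μ (s, πstar s)).toReal ∧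
    (count (fun i => D i ω) s (πstar s) : ℝ) < N * (μ (s, πstar s)).toReal / 2} with hG
  set U : S × A → Set Ω := fun p => {ω | (16000 * L ≤ N * (μ (p.1, πstar p.1)).toReal ∧
    10 * (μ (p.1, p.2)).toReal ≤ (μ (p.1, πstar p.1)).toReal) ∧
    N * (μ (p.1, πstar p.1)).toReal / 4 < (count (fun i => D i ω) p.1 p.2 : ℝ)} with hU
  have hsub : {ω | ¬ IsTypical B μ πstar (fun i => D i ω) L} ⊆
      ((⋃ q, R q) ∪ (⋃ s, G s)) ∪ ⋃ p, U p := by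
    intro ω hω
    by_contra hcon
    simp only [Set.mem_union, Set.mem_iUnion, not_or, not_exists] at hcon
    obtain ⟨⟨hR', hG'⟩, hU'⟩ := hcon
    refine hω ⟨fun s a hc => ?_, fun s hs => ?_, fun s a hs hd => ?_⟩
    · refine abs_empReward_sub_le _ s a hL hc fun σ hσ => ?_
      obtain ⟨k, hk⟩ := Nat.exists_eq_succ_of_ne_zero hc
      have hkN : k < N := by
        have := count_le (fun i => D i ω) s a
        omega
      have hlamk : 0.4 * Real.sqrt (2000 * L / (k.succ : ℕ)) = lam (k + 1) := rfl
      rw [hk, hlamk]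
      rcases hσ with rfl | rfl
      · simpa [hR] using hR' ((s, a), ⟨k, hkN⟩, true)
      · simpa [hR] using hR' ((s, a), ⟨k, hkN⟩, false)
    · by_contra hlt
      exact hG' s ⟨hs, not_le.1 hlt⟩
    · by_contra hlt
      exact hU' (s, a) ⟨⟨hs, hd⟩, not_le.1 hlt⟩
  have hRe : ∀ q, P (R q) ≤ e := fun q => measure_reward_deviation_le hind hlaw _ _ _ _
  have hGe : ∀ s, P (G s) ≤ e := fun s => by
    by_cases h : 16000 * L ≤ N * (μ (s, πstar s)).toReal
    · exact (measure_mono fun ω hω => hω.2).trans (measure_count_lt_le hind hlaw s _ h)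
    · simp [hG, h]
  have hUe : ∀ p, P (U p) ≤ e := fun p => by
    by_cases h : 16000 * L ≤ N * (μ (p.1, πstar p.1)).toReal ∧
        10 * (μ (p.1, p.2)).toReal ≤ (μ (p.1, πstar p.1)).toReal
    · exact (measure_mono fun ω hω => hω.2).trans
        (measure_lt_count_le hind hlaw p.1 p.2 h.1 ENNReal.toReal_nonneg h.2)
    · simp only [hU, h, false_and, Set.ofPred_false, measure_empty, zero_le]
  calc P {ω | ¬ IsTypical B μ πstar (fun i => D i ω) L}
      ≤ P (⋃ q, R q) + P (⋃ s, G s) + P (⋃ p, U p) :=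
        (measure_mono hsub).trans ((measure_union_le _ _).trans
          (add_le_add_left (measure_union_le _ _) _))
    _ ≤ Fintype.card ((S × A) × Fin N × Bool) * e + Fintype.card S * e +
          Fintype.card (S × A) * e := by
        gcongr
        · refine (measure_iUnion_fintype_le P R).trans ((Finset.sum_le_sum fun i _ => hRe i).trans ?_)
          simp
        · refine (measure_iUnion_fintype_le P G).trans ((Finset.sum_le_sum fun i _ => hGe i).trans ?_)
          simp
        · refine (measure_iUnion_fintype_le P U).trans ((Finset.sum_le_sum fun i _ => hUe i).trans ?_)
          simp
    _ = _ := by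
        rw [ENNReal.ofReal_mul (by positivity), ← he, ← add_mul, ← add_mul]
        congr 1
        rw [← ENNReal.ofReal_natCast, ← ENNReal.ofReal_natCast, ← ENNReal.ofReal_natCast,
          ← ENNReal.ofReal_add (by positivity) (by positivity),
          ← ENNReal.ofReal_add (by positivity) (by positivity)]
        congr 1
        simp
        ring

end Concentration

/-! ### Concentrability and the regret of a policy. -/

section Policies

variable {S A : Type*} [MeasurableSpace S] [MeasurableSpace A] {B : ContextualBandit S A}
  {πstar : S → A}

/-- Finiteness of the bound also covers μ = 0, where the convention x/0 = ∞ forces ρ = 0. -/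
lemma toReal_le_of_concentrability_le {μ : PMF (S × A)} {Cstar : ℝ} (hC0 : 0 ≤ Cstar)
    (hC : B.concentrability μ πstar ≤ ENNReal.ofReal Cstar) (s : S) :
    (B.ρ s).toReal ≤ Cstar * (μ (s, πstar s)).toReal := by
  have h1 : B.ρ s / μ (s, πstar s) ≤ ENNReal.ofReal Cstar :=
    (le_iSup (fun s => B.ρ s / μ (s, πstar s)) s).trans hC
  rw [ENNReal.div_le_iff_le_mul (.inr ENNReal.ofReal_ne_top) (.inl (μ.apply_ne_top _))] at h1
  have h2 := ENNReal.toReal_mono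
    (ENNReal.mul_ne_top ENNReal.ofReal_ne_top (μ.apply_ne_top _)) h1
  rwa [ENNReal.toReal_mul, ENNReal.toReal_ofReal hC0] at h2

variable [Fintype S]

lemma J_sub_J (B : ContextualBandit S A) (πstar π : S → A) :
    B.J πstar - B.J π =
      ∑ s, (B.ρ s).toReal * (B.meanReward s (πstar s) - B.meanReward s (π s)) := by
  simp only [ContextualBandit.J, ContextualBandit.value, ← Finset.sum_sub_distrib, mul_sub]

lemma J_sub_J_nonneg (hopt : B.IsOptimal πstar) (π : S → A) : 0 ≤ B.J πstar - B.J π := by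
  rw [J_sub_J]
  exact Finset.sum_nonneg fun s _ =>
    mul_nonneg ENNReal.toReal_nonneg (sub_nonneg.2 (hopt π s))

lemma J_sub_J_le_one (B : ContextualBandit S A) (πstar π : S → A) : B.J πstar - B.J π ≤ 1 := by
  rw [J_sub_J, ← sum_toReal_pmf B.ρ]
  refine Finset.sum_le_sum fun s _ => mul_le_of_le_one_right ENNReal.toReal_nonneg ?_
  linarith [meanReward_le_one B s (πstar s), meanReward_nonneg B s (π s)]

end Policies

/-! ### Regret in expectation and conclusion. -/

section Main

variable {S A : Type*} [Fintype S] [DecidableEq S] [MeasurableSpace S]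
  [Fintype A] [DecidableEq A] [MeasurableSpace A]
  {B : ContextualBandit S A} {μ : PMF (S × A)} {πstar π : S → A} {Cstar : ℝ} {N : ℕ}


/-- The regret of CB-LCB on a typical dataset. -/
lemma IsTypical.J_sub_J_le {D : Dataset S A N} {δ L : ℝ} (h : IsTypical B μ πstar D L)
    (hopt : B.IsOptimal πstar) (hC1 : 1 ≤ Cstar)
    (hC : B.concentrability μ πstar ≤ ENNReal.ofReal Cstar)
    (hL : L = Real.log (2 * (Fintype.card S : ℝ) * (Fintype.card A : ℝ) / δ)) (hLpos : 0 < L)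
    (hN : 0 < N) (hπ : IsLCBOutput D δ π) :
    B.J πstar - B.J π ≤ 32300 * Real.sqrt (Fintype.card S * (Cstar - 1) / N * L) +
      32000 * (Fintype.card S / N * L) := by
  rw [J_sub_J]
  refine sum_mul_gap_le (m := fun s => (μ (s, πstar s)).toReal)
    (mbar := fun s => ∑ a ∈ Finset.univ.erase (πstar s), (μ (s, a)).toReal)
    (sum_toReal_pmf B.ρ) (fun s => ENNReal.toReal_nonneg)
    (fun s => Finset.sum_nonneg fun a _ => ENNReal.toReal_nonneg) ?_ hC1 hLpos
    (by exact_mod_cast hN) (toReal_le_of_concentrability_le (by linarith) hC)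
    (fun s => ENNReal.toReal_nonneg) (fun s => sub_nonneg.2 (hopt π s)) (fun s => ?_)
    (fun s hs => h.gap_le hL hLpos hπ hs) (fun s hs hd => ?_)
  · rw [← Finset.sum_add_distrib, ← sum_toReal_pmf μ, Fintype.sum_prod_type]
    exact Finset.sum_congr rfl fun s _ =>
      Finset.add_sum_erase _ (fun a => (μ (s, a)).toReal) (Finset.mem_univ _)
  · linarith [meanReward_le_one B s (πstar s), meanReward_nonneg B s (π s)]
  · rw [h.eq_of_dominates hopt hL hLpos hπ hs fun a ha => ?_, sub_self]
    refine le_trans ?_ hd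
    gcongr
    exact Finset.single_le_sum (f := fun a => (μ (s, a)).toReal)
      (fun a _ => ENNReal.toReal_nonneg) (Finset.mem_erase.2 ⟨ha, Finset.mem_univ a⟩)

/-- A function in `[0, 1]` that is at most `C` outside an event of probability `ε` has mean at most
`C + ε`. -/
lemma integral_le_add_of_measure_le {Ω : Type*} [MeasurableSpace Ω] {P : Measure Ω}
    [IsProbabilityMeasure P] {f : Ω → ℝ} {C ε : ℝ} (hC : 0 ≤ C) (hε : 0 ≤ ε)
    (h0 : ∀ ω, 0 ≤ f ω) (h1 : ∀ ω, f ω ≤ 1) {E : Set Ω} (hE : P E ≤ ENNReal.ofReal ε)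
    (hf : ∀ ω, ω ∉ E → f ω ≤ C) : ∫ ω, f ω ∂P ≤ C + ε := by
  -- E need not be measurable; its measurable hull has the same probability.
  have hmeas := measurableSet_toMeasurable P E
  have hint : Integrable (fun ω => C + (toMeasurable P E).indicator (fun _ => (1 : ℝ)) ω) P :=
    (integrable_const C).add ((integrable_const 1).indicator hmeas)
  calc ∫ ω, f ω ∂P ≤ ∫ ω, (C + (toMeasurable P E).indicator (fun _ => (1 : ℝ)) ω) ∂P := by
        refine integral_mono_of_nonneg (.of_forall h0) hint (.of_forall fun ω => ?_)
        by_cases hω : ω ∈ toMeasurable P E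
        · simp only [Set.indicator_of_mem hω]
          linarith [h1 ω]
        · simp only [Set.indicator_of_notMem hω, add_zero]
          exact hf ω fun hE => hω (subset_toMeasurable P E hE)
    _ = C + P.real E := by
        rw [integral_add (integrable_const C) ((integrable_const 1).indicator hmeas),
          integral_indicator_const _ hmeas]
        simp [Measure.real, measure_toMeasurable]
    _ ≤ C + ε := by
        gcongr
        exact ENNReal.toReal_le_of_le_ofReal hε hE

lemma failure_probability_le {s a n L : ℝ} (hs : 2 ≤ s) (ha : 1 ≤ a) (hn : 1 ≤ n)
    (hL : L = Real.log (2 * s * a * n)) (hLpos : 0 < L) :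
    (2 * (s * a * n) + s + s * a) * Real.exp (-(40 * L)) ≤ 1 / n := by
  set M := 2 * s * a * n with hM
  have hsa : s ≤ s * a := le_mul_of_one_le_right (by linarith) ha
  have hsan : s * a ≤ s * a * n := le_mul_of_one_le_right (by positivity) hn
  have hMn : 4 * n ≤ M := by
    rw [hM]
    gcongr
    linarith
  have hMpos : 0 < M := by linarith
  -- Since M = exp L, the failure factor is M⁻⁴⁰; M⁻² already beats the at most 2·M events.
  have hexp : Real.exp (-(40 * L)) ≤ 1 / (M * M) := by
    calc Real.exp (-(40 * L)) ≤ Real.exp (-(L + L)) := Real.exp_le_exp.2 (by linarith)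
      _ = _ := by rw [Real.exp_neg, Real.exp_add, hL, Real.exp_log hMpos, one_div]
  calc (2 * (s * a * n) + s + s * a) * Real.exp (-(40 * L)) ≤ (2 * M) * (1 / (M * M)) := by
        gcongr
        rw [hM]
        linarith
    _ = 2 / M := by field_simp
    _ ≤ 2 / (4 * n) := by gcongr
    _ ≤ 1 / n := by
        rw [div_le_div_iff₀ (by linarith) (by linarith)]
        linarith

end Main

end OfflineCB

end

theorem mainTheorem1 :
    ∃ c : ℝ, 0 < c ∧
      ∀ (S A : Type*)
        [Fintype S] [DecidableEq S] [MeasurableSpace S] [MeasurableSingletonClass S]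
        [Fintype A] [DecidableEq A] [MeasurableSpace A] [MeasurableSingletonClass A]
        (B : OfflineCB.ContextualBandit S A) (μ : PMF (S × A)) (πstar : S → A)
        (Cstar : ℝ) (N : ℕ)
        (Ω : Type*) [MeasurableSpace Ω] (P : Measure Ω) [IsProbabilityMeasure P]
        (D : Fin N → Ω → OfflineCB.Sample S A) (πhat : Ω → S → A),
        2 ≤ Fintype.card S →
        1 ≤ N →
        1 ≤ Cstar →
        B.IsOptimal πstar →
        B.concentrability μ πstar ≤ ENNReal.ofReal Cstar →
        iIndepFun D P →
        (∀ i, HasLaw (D i) (B.sampleLaw μ) P) →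
        Measurable πhat →
        (∀ ω, OfflineCB.IsLCBOutput (fun i => D i ω) (1 / (N : ℝ)) (πhat ω)) →
        ∫ ω, (B.J πstar - B.J (πhat ω)) ∂P ≤
          c * min 1
            (Real.sqrt ((Fintype.card S : ℝ) * (Cstar - 1) / N *
                Real.log (2 * (Fintype.card S : ℝ) * (Fintype.card A : ℝ) * N)) +
              (Fintype.card S : ℝ) / N *
                Real.log (2 * (Fintype.card S : ℝ) * (Fintype.card A : ℝ) * N)) := by
  refine ⟨40000, by norm_num, ?_⟩
  intro S A _ _ _ _ _ _ _ _ B μ πstar Cstar N Ω _ P _ D πhat hS hN hC1 hopt hC hind hlaw _ hπ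
  have hSne : Nonempty S := Fintype.card_pos_iff.1 (by omega)
  have hAne : Nonempty A := hSne.map πstar
  have hs : (2 : ℝ) ≤ Fintype.card S := by exact_mod_cast hS
  have ha : (1 : ℝ) ≤ Fintype.card A := by exact_mod_cast Fintype.card_pos (α := A)
  have hn : (1 : ℝ) ≤ N := by exact_mod_cast hN
  set L := Real.log (2 * (Fintype.card S : ℝ) * (Fintype.card A : ℝ) * N) with hL
  have hsa : (Fintype.card S : ℝ) ≤ Fintype.card S * Fintype.card A :=
    le_mul_of_one_le_right (by linarith) ha
  have hsan : (Fintype.card S * Fintype.card A : ℝ) ≤ Fintype.card S * Fintype.card A * N :=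
    le_mul_of_one_le_right (by linarith) hn
  have hL1 : 1 ≤ L := by
    rw [hL, Real.le_log_iff_exp_le (by positivity)]
    have := Real.exp_one_lt_d9
    linarith
  have hLpos : 0 < L := by linarith
  have hδ : L = Real.log (2 * (Fintype.card S : ℝ) * (Fintype.card A : ℝ) / (1 / N)) := by
    rw [hL, one_div, div_inv_eq_mul]
  set X := Real.sqrt ((Fintype.card S : ℝ) * (Cstar - 1) / N * L) with hX
  have hX0 : 0 ≤ X := Real.sqrt_nonneg _
  have hY0 : 0 ≤ (Fintype.card S : ℝ) / N * L := by positivity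
  -- The failure probability 1/N is absorbed into the S·L/N term.
  have hY1 : 1 / (N : ℝ) ≤ (Fintype.card S : ℝ) / N * L := by
    rw [div_mul_eq_mul_div]
    gcongr
    nlinarith
  have h0 : ∀ ω, 0 ≤ B.J πstar - B.J (πhat ω) := fun ω => OfflineCB.J_sub_J_nonneg hopt _
  have h1 : ∀ ω, B.J πstar - B.J (πhat ω) ≤ 1 := fun ω => OfflineCB.J_sub_J_le_one B _ _
  rw [mul_min_of_nonneg _ _ (by norm_num)]
  refine le_min ?_ ?_
  · have := OfflineCB.integral_le_add_of_measure_le (P := P) (E := ∅) zero_le_one le_rfl h0 h1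
      (by simp) fun ω _ => h1 ω
    linarith
  · have hE := (OfflineCB.measure_not_isTypical_le hind hlaw πstar hLpos).trans
      (ENNReal.ofReal_le_ofReal (OfflineCB.failure_probability_le hs ha hn hL hLpos))
    have := OfflineCB.integral_le_add_of_measure_le (P := P)
      (C := 32300 * X + 32000 * (Fintype.card S / N * L)) (by positivity) (by positivity)
      h0 h1 hE fun ω hω =>
        (not_not.1 hω).J_sub_J_le hopt hC1 hC hδ hLpos hN (hπ ω)
    linarith
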